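/- Let $\xi=\frac{3-\sqrt5}{2}$, let $n\ge 1$, let $0<\varepsilon<1$, put $r=\lceil \log_2\log_{1+\xi}\frac1\varepsilon\rceil$, and assume $r\ge -1$ (equivalently $\varepsilon<(1+\xi)^{-1/4}$). Let $\mathcal P_n$ be the set of all probability distributions $F$ of reward vectors $v=(v_1,\dots,v_n)\in\mathbb R_{\ge0}^n$ whose coordinates are pairwise independent. For $F\in\mathcal P_n$ call reals $T_0,T_1,T_2,\dots$ admissible thresholds if $$\sum_{i=1}^n\Pr[v_i>T_0]\le \xi\le\sum_{i=1}^n\Pr[v_i\ge T_0]$$ and, with $p=\Pr[\max_i v_i<T_0]$, for every $j\ge1$ the number $T_j$ is a $p^{2^j}$-quantile threshold of $\max_i v_i$, i.e. $\Pr[\max_i v_i<T_j]\le p^{2^j}\le \Pr[\max_i v_i\le T_j]$. Admissible thresholds exist for every $F\in\mathcal P_n$. Consider the following online algorithm $\mathrm{ALG}$, which is given $F$ and $\varepsilon$, fixes admissible thresholds for $F$, and observes one by one the rewards of rounds $v^{(1)},v^{(2)},\dots$ drawn independently from $F$. In rounds $1$ and $2$ it selects the first reward that is $>T_0$. If nothing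 was selected there, it continues with $r+2$ further rounds, and in the $s$-th of these ($s=1,\dots,r+2$) it selects the first reward that is $\ge T_{\max\{s-2,0\}}$. It stops after its first selection, its value is the selected reward, and its value is $0$ if nothing is selected (in particular, it ignores all rounds after the first $r+4$). Then, for every choice of admissible thresholds, the $(1-\varepsilon)$-competition complexity of $\mathrm{ALG}$ on $\mathcal P_n$, that is, the smallest positive integer $K$ such that for every $F\in\mathcal P_n$ and every $k\ge K$ $$\mathbb E_{v\sim F^k}[\mathrm{ALG}(v)]\ \ge\ (1-\varepsilon)\,\mathbb E_{v\sim F}\bigl[\max_i v_i\bigr],$$ is at most $r+4=\lceil \log_2\log_{1+\xi}\frac1\varepsilon\rceil+4$, independently of $n$. -/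

import Mathlib

open MeasureTheory ProbabilityTheory
open scoped NNReal ENNReal

noncomputable section

namespace Prophet

/-- A distribution on sequences of `n` non-negative rewards is a probability measure on
`Fin n → ℝ≥0`; this is the class of those whose rewards are pairwise independent. -/
def pairwiseIndependent (n : ℕ) : Set (Measure (Fin n → ℝ≥0)) :=
  {F | IsProbabilityMeasure F ∧
    Pairwise fun i j : Fin n => IndepFun (fun v : Fin n → ℝ≥0 => v i) (fun v => v j) F}

/-- The prophet's value `max_i v_i`. -/
def maxReward {n : ℕ} (v : Fin n → ℝ≥0) : ℝ≥0 := Finset.univ.sup v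

/-- An algorithm: it knows the distribution `F` of a round and the number `k` of rounds, and
`ALG F k v` is the value it gets on the realized rounds `v 0, …, v (k - 1)`
(`0` if nothing is selected). -/
abbrev Algorithm (n : ℕ) : Type :=
  Measure (Fin n → ℝ≥0) → (k : ℕ) → (Fin k → Fin n → ℝ≥0) → ℝ≥0

/-- For every `F` in the class and every `k ≥ K`, the expected value of the algorithm on `k`
independent rounds is at least `(1 - ε)` times the expected maximum of one round. The expectations
are those of non-negative variables and may be infinite. -/
def Suffices {n : ℕ} (C : Set (Measure (Fin n → ℝ≥0))) (ALG : Algorithm n) (ε : ℝ) (K : ℕ) :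
    Prop :=
  ∀ F ∈ C, ∀ k : ℕ, K ≤ k →
    ENNReal.ofReal (1 - ε) * ∫⁻ v, (maxReward v : ℝ≥0∞) ∂F
      ≤ ∫⁻ v, (ALG F k v : ℝ≥0∞) ∂(Measure.pi fun _ : Fin k => F)

/-- The `(1 - ε)`-competition complexity of `ALG` on the class `C`: the smallest positive integer
that suffices (`⊤` if there is none). -/
def competitionComplexity {n : ℕ} (C : Set (Measure (Fin n → ℝ≥0))) (ALG : Algorithm n)
    (ε : ℝ) : ℕ∞ :=
  ⨅ (K : ℕ) (_ : 0 < K ∧ Suffices C ALG ε K), (K : ℕ∞)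

/-- `T` is a `q`-quantile threshold of the law of `max_i v_i`, `v ∼ F`. -/
def IsMaxQuantile {n : ℕ} (F : Measure (Fin n → ℝ≥0)) (q T : ℝ) : Prop :=
  F.real {v | (maxReward v : ℝ) < T} ≤ q ∧ q ≤ F.real {v | (maxReward v : ℝ) ≤ T}

/-- The constant `ξ = (3 - √5) / 2`. -/
def xi : ℝ := (3 - √5) / 2

/-- `T 0, T 1, …` are thresholds that the algorithm may use on `F`:
`∑ i, Pr[v_i > T 0] ≤ ξ ≤ ∑ i, Pr[v_i ≥ T 0]`, and, with `p = Pr[max_i v_i < T 0]`, for `j ≥ 1`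
the number `T j` is a `p ^ (2 ^ j)`-quantile threshold of the law of the maximum. -/
def AreThresholds {n : ℕ} (F : Measure (Fin n → ℝ≥0)) (T : ℕ → ℝ) : Prop :=
  (∑ i, F.real {v | T 0 < (v i : ℝ)} ≤ xi ∧ xi ≤ ∑ i, F.real {v | T 0 ≤ (v i : ℝ)}) ∧
  ∀ j : ℕ, 1 ≤ j → IsMaxQuantile F (F.real {v | (maxReward v : ℝ) < T 0} ^ (2 ^ j)) (T j)

/-- The `n * k` rewards in their order of arrival, round after round, each with the number of its
round (rounds are numbered from `0`). -/
def arrivals {n k : ℕ} (v : Fin k → Fin n → ℝ≥0) : List (ℕ × ℝ≥0) :=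
  (List.finRange k).flatMap fun t : Fin k => List.ofFn fun i => ((t : ℕ), v t i)

open Classical in
/-- Observe the rewards one by one and select the first one that passes the test `P t` of its
round `t`; the value is `0` if there is none. -/
def scan {n k : ℕ} (P : ℕ → ℝ≥0 → Prop) (v : Fin k → Fin n → ℝ≥0) : ℝ≥0 :=
  ((arrivals v).find? fun a => decide (P a.1 a.2)).elim 0 Prod.snd

/-- The test in round `t`. The first phase consists of the rounds `t = 0, 1`, with the test
`x > T 0`. The second phase consists of the next `m` rounds, with the test `x ≥ T (max (s - 2) 0)`
in its `s`-th round, `s = 1, …, m`; as `s = t - 1`, the index is the truncated difference `t - 3`.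
No reward is accepted after that. -/
def accepts (T : ℕ → ℝ) (m : ℕ) (t : ℕ) (x : ℝ≥0) : Prop :=
  if t < 2 then T 0 < (x : ℝ) else t < 2 + m ∧ T (t - 3) ≤ (x : ℝ)

/-- `⌈log₂ log_{1+ξ} (1/ε)⌉`. -/
def rounds (ε : ℝ) : ℤ := ⌈Real.logb 2 (Real.logb (1 + xi) (1 / ε))⌉

/-- The two-phase algorithm with target approximation `ε`, where `T F` are the thresholds it uses
on `F`; the second phase has `⌈log₂ log_{1+ξ} (1/ε)⌉ + 2` rounds. -/
def twoPhase (n : ℕ) (T : Measure (Fin n → ℝ≥0) → ℕ → ℝ) (ε : ℝ) : Algorithm n :=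
  fun F _ v => scan (accepts (T F) (rounds ε + 2).toNat) v

end Prophet

end

/- By the layer cake formula it suffices to show `(1 - ε) Pr[max v > t] ≤ Pr[ALG > t]` for every
`t`. If `t ≥ T 0`, let `S = ∑ i, Pr[v_i > t]`, which bounds `Pr[max v > t]`. In one round, the
unique reward above `T 0` is even above `t` with probability at least `S (1 - ξ)`, and a round has
no reward above `T 0` with probability at least `1 - ξ`. Hence the first two rounds earn more than
`t` with probability at least `S (1 - ξ) (1 + (1 - ξ)) = S`.

If `t < T 0`, let `T l` be the first threshold that is at most `t`. If any of the first `l + 1`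
rounds of the second phase accepts a reward, the algorithm earns more than `t`. All of them fail
with probability at most `p · p · p ^ 2 · p ^ 4 ⋯ p ^ 2 ^ (l - 1) = p ^ 2 ^ l ≤ Pr[max v ≤ t]`.
If there is no such `l` within the horizon, all rounds of the second phase fail with probability at
most `p ^ 2 ^ (r + 1)`. The second moment method for the number of rewards that are at least `T 0`
gives `p ≤ 1 / (1 + ξ)`, so this probability is at most `ε`. -/

namespace Prophet

open Filter Topology

section Measure

variable {Ω ι : Type*} [MeasurableSpace Ω] {μ : Measure Ω}

lemma measureReal_setOf_lt_eq_one_sub [IsProbabilityMeasure μ] {f : Ω → ℝ} (hf : Measurable f)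
    (t : ℝ) : μ.real {ω | t < f ω} = 1 - μ.real {ω | f ω ≤ t} := by
  rw [← probReal_compl_eq_one_sub (s := {ω | f ω ≤ t}) (hf measurableSet_Iic)]
  simp only [Set.compl_ofPred, not_le]

lemma measureReal_setOf_le_eq_one_sub [IsProbabilityMeasure μ] {f : Ω → ℝ} (hf : Measurable f)
    (t : ℝ) : μ.real {ω | t ≤ f ω} = 1 - μ.real {ω | f ω < t} := by
  rw [← probReal_compl_eq_one_sub (s := {ω | f ω < t}) (hf measurableSet_Iio)]
  simp only [Set.compl_ofPred, not_lt]

lemma mul_lintegral_le_of_forall_mul_meas_lt_le {Ω' : Type*} [MeasurableSpace Ω']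
    {ν : Measure Ω'} {f : Ω → ℝ≥0} {g : Ω' → ℝ≥0} (hf : Measurable f) (hg : Measurable g)
    {c : ℝ≥0∞} (hc : c ≠ ∞)
    (h : ∀ t : ℝ, c * μ {ω | t < (f ω : ℝ)} ≤ ν {ω | t < (g ω : ℝ)}) :
    c * ∫⁻ ω, (f ω : ℝ≥0∞) ∂μ ≤ ∫⁻ ω, (g ω : ℝ≥0∞) ∂ν := by
  have layer_cake_f := lintegral_eq_lintegral_meas_lt μ
    (Eventually.of_forall fun ω => (f ω).coe_nonneg) hf.coe_nnreal_real.aemeasurable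
  have layer_cake_g := lintegral_eq_lintegral_meas_lt ν
    (Eventually.of_forall fun ω => (g ω).coe_nonneg) hg.coe_nnreal_real.aemeasurable
  simp only [ENNReal.ofReal_coe_nnreal] at layer_cake_f layer_cake_g
  rw [layer_cake_f, layer_cake_g, ← lintegral_const_mul' _ _ hc]
  exact lintegral_mono h

lemma measureReal_pi_forall_mem {κ : Type*} [Fintype ι] [Fintype κ] {Ω : κ → Type*}
    [∀ k, MeasurableSpace (Ω k)] (μ : ∀ k, Measure (Ω k)) [∀ k, IsProbabilityMeasure (μ k)]
    {g : ι → κ} (hg : g.Injective) {B : ∀ i, Set (Ω (g i))} (hB : ∀ i, MeasurableSet (B i)) :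
    (Measure.pi μ).real {v | ∀ i, v (g i) ∈ B i} = ∏ i, (μ (g i)).real (B i) := by
  have hindep : iIndepFun (fun i (v : ∀ k, Ω k) => v (g i)) (Measure.pi μ) :=
    (iIndepFun_pi (X := fun _ => id) fun _ => aemeasurable_id).precomp hg
  have h := hindep.measure_inter_preimage_eq_mul Finset.univ (sets := B) fun i _ => hB i
  have hset : {v : ∀ k, Ω k | ∀ i, v (g i) ∈ B i}
      = ⋂ i ∈ Finset.univ, (fun v => v (g i)) ⁻¹' B i := by
    ext; simp
  rw [hset, measureReal_def, h, ENNReal.toReal_prod]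
  exact Finset.prod_congr rfl fun i _ =>
    (measurePreserving_eval μ (g i)).measureReal_preimage (hB i).nullMeasurableSet

lemma measureReal_pi_mem_or_mem_and_mem {κ : Type*} [Fintype κ] [IsProbabilityMeasure μ]
    {s t : κ} (hst : s ≠ t) {A B : Set Ω} (hA : MeasurableSet A) (hB : MeasurableSet B)
    (hAB : Disjoint A B) :
    (Measure.pi fun _ : κ => μ).real {v | v s ∈ A ∨ v s ∈ B ∧ v t ∈ A}
      = μ.real A + μ.real B * μ.real A := by
  have hfirst : (Measure.pi fun _ : κ => μ).real {v | v s ∈ A} = μ.real A :=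
    (measurePreserving_eval (fun _ : κ => μ) s).measureReal_preimage hA.nullMeasurableSet
  have hsecond : (Measure.pi fun _ : κ => μ).real {v | v s ∈ B ∧ v t ∈ A}
      = μ.real B * μ.real A := by
    have hinj : Function.Injective ![s, t] := by
      simp [Function.Injective, Fin.forall_fin_two, hst, hst.symm]
    simpa [Fin.forall_fin_two, Fin.prod_univ_two] using
      measureReal_pi_forall_mem (fun _ : κ => μ) hinj (B := ![B, A])
        (by simp [Fin.forall_fin_two, hA, hB])
  have hdisj : Disjoint {v : κ → Ω | v s ∈ A} {v | v s ∈ B ∧ v t ∈ A} :=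
    Set.disjoint_left.2 fun v h h' => Set.disjoint_left.1 hAB h h'.1
  rw [Set.ofPred_or, measureReal_union hdisj, hfirst, hsecond]
  exact (measurable_pi_apply s hB).inter (measurable_pi_apply t hA)

end Measure

section Quantile

variable {ν : Measure ℝ} [IsFiniteMeasure ν] {c T : ℝ}

lemma measureReal_Iio_le_of_forall_lt (h : ∀ x < T, ν.real (Set.Iic x) ≤ c) :
    ν.real (Set.Iio T) ≤ c := by
  obtain ⟨u, hu, hlt, hlim⟩ := exists_seq_strictMono_tendsto T
  have hUnion : ⋃ m, Set.Iic (u m) = Set.Iio T := iUnion_Iic_eq_Iio_of_lt_of_tendsto hlt hlim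
  have htendsto := tendsto_measure_iUnion_atTop (μ := ν) fun a b hab =>
    Set.Iic_subset_Iic.2 (hu.monotone hab)
  rw [hUnion] at htendsto
  exact le_of_tendsto' ((ENNReal.tendsto_toReal (measure_ne_top ν _)).comp htendsto)
    fun m => h _ (hlt m)

lemma le_measureReal_Iic_of_forall_gt (h : ∀ x > T, c ≤ ν.real (Set.Iic x)) :
    c ≤ ν.real (Set.Iic T) := by
  obtain ⟨u, hu, hlt, hlim⟩ := exists_seq_strictAnti_tendsto T
  have hInter : ⋂ m, Set.Iic (u m) = Set.Iic T := by
    ext x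
    simp only [Set.mem_iInter, Set.mem_Iic]
    exact ⟨fun hx => ge_of_tendsto' hlim hx, fun hx m => hx.trans (hlt m).le⟩
  have htendsto := tendsto_measure_iInter_atTop (μ := ν) (s := fun m => Set.Iic (u m))
    (fun m => measurableSet_Iic.nullMeasurableSet)
    (fun a b hab => Set.Iic_subset_Iic.2 (hu.antitone hab)) ⟨0, measure_ne_top ν _⟩
  rw [hInter] at htendsto
  exact ge_of_tendsto' ((ENNReal.tendsto_toReal (measure_ne_top ν _)).comp htendsto)
    fun m => h _ (hlt m)

lemma exists_quantile {a : ℝ} (ha : ν.real (Set.Iio a) ≤ c) (hc : c < ν.real Set.univ) :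
    ∃ T, ν.real (Set.Iio T) ≤ c ∧ c ≤ ν.real (Set.Iic T) := by
  set S : Set ℝ := {x | c < ν.real (Set.Iic x)}
  have hne : S.Nonempty :=
    (((ENNReal.tendsto_toReal (measure_ne_top ν _)).comp
      (tendsto_measure_Iic_atTop ν)).eventually (lt_mem_nhds hc)).exists
  have hbdd : BddBelow S := ⟨a, fun x hx => not_lt.1 fun hxa =>
    (hx.trans_le ((measureReal_mono (Set.Iic_subset_Iio.2 hxa)).trans ha)).false⟩
  refine ⟨sInf S, measureReal_Iio_le_of_forall_lt fun x hx => ?_,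
    le_measureReal_Iic_of_forall_gt fun x hx => ?_⟩
  · exact not_lt.1 fun hxS => (csInf_le hbdd hxS).not_gt hx
  · obtain ⟨y, hyS, hyx⟩ := exists_lt_of_csInf_lt hne hx
    exact hyS.le.trans (measureReal_mono (Set.Iic_subset_Iic.2 hyx.le))

lemma exists_sum_quantile {Ω ι : Type*} [MeasurableSpace Ω] [Fintype ι] {μ : Measure Ω}
    [IsFiniteMeasure μ] {f : ι → Ω → ℝ} (hf : ∀ i, Measurable (f i)) {a : ℝ}
    (ha : ∑ i, μ.real {ω | f i ω < a} ≤ c) (hc : c < Fintype.card ι * μ.real Set.univ) :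
    ∃ T, ∑ i, μ.real {ω | f i ω < T} ≤ c ∧ c ≤ ∑ i, μ.real {ω | f i ω ≤ T} := by
  set ν : Measure ℝ := ∑ i, μ.map (f i)
  have hν : ∀ A : Set ℝ, MeasurableSet A → ν.real A = ∑ i, μ.real (f i ⁻¹' A) := by
    intro A hA
    rw [measureReal_def, Measure.finsetSum_apply,
      ENNReal.toReal_sum fun i _ => measure_ne_top _ _]
    exact Finset.sum_congr rfl fun i _ => map_measureReal_apply (hf i) hA
  obtain ⟨T, hlt, hle⟩ := exists_quantile (ν := ν) (a := a)
    ((hν _ measurableSet_Iio).trans_le ha) (by simpa [hν _ MeasurableSet.univ] using hc)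
  exact ⟨T, (hν _ measurableSet_Iio).symm.trans_le hlt, hle.trans_eq (hν _ measurableSet_Iic)⟩

end Quantile

section Events

lemma sq_sum_indicator_one {Ω ι : Type*} [Fintype ι] (E : ι → Set Ω) (ω : Ω) :
    (∑ i, (E i).indicator (1 : Ω → ℝ) ω) ^ 2
      = ∑ ij : ι × ι, (E ij.1 ∩ E ij.2).indicator 1 ω := by
  simp only [sq, Finset.sum_mul_sum, Fintype.sum_prod_type, Set.inter_indicator_one, Pi.mul_apply]

variable {Ω ι : Type*} [MeasurableSpace Ω] {μ : Measure Ω} [Fintype ι]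

lemma measureReal_eq_zero_le [IsProbabilityMeasure μ] {X : Ω → ℝ} (hX : MemLp X 2 μ) (d : ℝ) :
    μ.real {ω | X ω = 0} ≤ 1 - 2 * d * ∫ ω, X ω ∂μ + d ^ 2 * ∫ ω, X ω ^ 2 ∂μ := by
  have hX1 : Integrable X μ := hX.integrable one_le_two
  have hlin : Integrable (fun ω => 1 - 2 * d * X ω) μ :=
    (integrable_const 1).sub (hX1.const_mul _)
  have hquad : Integrable (fun ω => 1 - 2 * d * X ω + d ^ 2 * X ω ^ 2) μ :=
    hlin.add (hX.integrable_sq.const_mul _)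
  calc μ.real {ω | X ω = 0}
      ≤ μ.real {ω | 1 ≤ 1 - 2 * d * X ω + d ^ 2 * X ω ^ 2} :=
        measureReal_mono fun ω (hω : X ω = 0) => by simp [hω]
    _ ≤ ∫ ω, (1 - 2 * d * X ω + d ^ 2 * X ω ^ 2) ∂μ := by
        simpa using mul_meas_ge_le_integral_of_nonneg
          (Eventually.of_forall fun ω => by
            change 0 ≤ 1 - 2 * d * X ω + d ^ 2 * X ω ^ 2
            nlinarith [sq_nonneg (1 - d * X ω)]) hquad 1
    _ = 1 - 2 * d * ∫ ω, X ω ∂μ + d ^ 2 * ∫ ω, X ω ^ 2 ∂μ := by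
        rw [integral_add hlin (hX.integrable_sq.const_mul _),
          integral_sub (integrable_const 1) (hX1.const_mul _), integral_const_mul,
          integral_const_mul]
        simp

lemma integral_sum_indicator_one [IsFiniteMeasure μ] {E : ι → Set Ω}
    (hE : ∀ i, MeasurableSet (E i)) :
    ∫ ω, ∑ i, (E i).indicator 1 ω ∂μ = ∑ i, μ.real (E i) := by
  rw [integral_finsetSum _ fun i _ => (integrable_const _).indicator (hE i)]
  exact Finset.sum_congr rfl fun i _ => integral_indicator_one (hE i)

lemma integral_sq_sum_indicator_one_le [IsProbabilityMeasure μ] {E : ι → Set Ω}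
    (hE : ∀ i, MeasurableSet (E i))
    (hneg : ∀ i j, i ≠ j → μ.real (E i ∩ E j) ≤ μ.real (E i) * μ.real (E j)) :
    ∫ ω, (∑ i, (E i).indicator 1 ω) ^ 2 ∂μ
      ≤ ∑ i, μ.real (E i) + (∑ i, μ.real (E i)) ^ 2 := by
  classical
  have hpair : ∀ i j, μ.real (E i ∩ E j)
      ≤ (if j = i then μ.real (E i) else 0) + μ.real (E i) * μ.real (E j) := by
    intro i j
    split_ifs with hij
    · subst hij
      rw [Set.inter_self]
      exact le_add_of_nonneg_right (by positivity)
    · rw [zero_add]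
      exact hneg i j (Ne.symm hij)
  calc ∫ ω, (∑ i, (E i).indicator 1 ω) ^ 2 ∂μ
      = ∑ i, ∑ j, μ.real (E i ∩ E j) := by
        simp only [sq_sum_indicator_one]
        rw [integral_sum_indicator_one fun ij : ι × ι => (hE ij.1).inter (hE ij.2),
          Fintype.sum_prod_type]
    _ ≤ ∑ i, ∑ j, ((if j = i then μ.real (E i) else 0) + μ.real (E i) * μ.real (E j)) :=
        Finset.sum_le_sum fun i _ => Finset.sum_le_sum fun j _ => hpair i j
    _ = ∑ i, μ.real (E i) + (∑ i, μ.real (E i)) ^ 2 := by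
        simp only [Finset.sum_add_distrib, Finset.sum_ite_eq', Finset.mem_univ, if_true, sq,
          Finset.sum_mul_sum]

lemma measureReal_forall_notMem_le [IsProbabilityMeasure μ] {E : ι → Set Ω}
    (hE : ∀ i, MeasurableSet (E i))
    (hneg : ∀ i j, i ≠ j → μ.real (E i ∩ E j) ≤ μ.real (E i) * μ.real (E j)) :
    μ.real {ω | ∀ i, ω ∉ E i} ≤ 1 / (1 + ∑ i, μ.real (E i)) := by
  set s := ∑ i, μ.real (E i)
  have hs : 0 ≤ s := Finset.sum_nonneg fun i _ => measureReal_nonneg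
  set N : Ω → ℝ := fun ω => ∑ i, (E i).indicator 1 ω
  have hN : MemLp N 2 μ :=
    memLp_finsetSum _ fun i _ => (memLp_const (1 : ℝ)).indicator (hE i)
  -- `1 / (1 + s)` minimizes the bound `1 - 2 d s + d² (s + s²)` of the second moment method.
  set d := 1 / (1 + s) with hd
  calc μ.real {ω | ∀ i, ω ∉ E i}
      ≤ μ.real {ω | N ω = 0} := measureReal_mono fun ω hω =>
        Finset.sum_eq_zero fun i _ => Set.indicator_of_notMem (hω i) _
    _ ≤ 1 - 2 * d * ∫ ω, N ω ∂μ + d ^ 2 * ∫ ω, N ω ^ 2 ∂μ := measureReal_eq_zero_le hN d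
    _ ≤ 1 - 2 * d * s + d ^ 2 * (s + s ^ 2) := by
        rw [integral_sum_indicator_one hE]
        gcongr
        exact integral_sq_sum_indicator_one_le hE hneg
    _ = 1 / (1 + s) := by
        rw [hd]
        field_simp
        ring

lemma sum_mul_le_measureReal_exists_forall_ne [IsFiniteMeasure μ] {A B : ι → Set Ω}
    (hA : ∀ i, MeasurableSet (A i)) (hB : ∀ i, MeasurableSet (B i)) (hBA : ∀ i, B i ⊆ A i)
    (hneg : ∀ i j, i ≠ j → μ.real (B i ∩ A j) ≤ μ.real (B i) * μ.real (A j)) :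
    (∑ i, μ.real (B i)) * (1 - ∑ i, μ.real (A i))
      ≤ μ.real {ω | ∃ i, ω ∈ B i ∧ ∀ j, j ≠ i → ω ∉ A j} := by
  classical
  set D : ι → Set Ω := fun i => B i \ ⋃ j ∈ Finset.univ.erase i, A j with hD
  have hDm : ∀ i, MeasurableSet (D i) := fun i =>
    (hB i).diff (Finset.measurableSet_biUnion _ fun j _ => hA j)
  have hdisj : Pairwise (Function.onFun Disjoint D) := fun i j hij =>
    Set.disjoint_left.2 fun ω hi hj => hj.2 <|
      Set.mem_biUnion (Finset.mem_erase.2 ⟨hij, Finset.mem_univ i⟩) (hBA i hi.1)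
  have hunion : {ω | ∃ i, ω ∈ B i ∧ ∀ j, j ≠ i → ω ∉ A j} = ⋃ i, D i := by
    ext ω
    simp [hD]
  have hcollision : ∀ i, μ.real (B i ∩ ⋃ j ∈ Finset.univ.erase i, A j)
      ≤ μ.real (B i) * ∑ j, μ.real (A j) := by
    intro i
    calc μ.real (B i ∩ ⋃ j ∈ Finset.univ.erase i, A j)
        ≤ ∑ j ∈ Finset.univ.erase i, μ.real (B i ∩ A j) := by
          rw [Set.inter_iUnion₂]
          exact measureReal_biUnion_finset_le _ _
      _ ≤ ∑ j ∈ Finset.univ.erase i, μ.real (B i) * μ.real (A j) :=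
          Finset.sum_le_sum fun j hj => hneg i j (Finset.ne_of_mem_erase hj).symm
      _ ≤ μ.real (B i) * ∑ j, μ.real (A j) := by
          rw [Finset.mul_sum]
          exact Finset.sum_le_univ_sum_of_nonneg fun j => by positivity
  rw [hunion, measureReal_iUnion_fintype hdisj hDm, Finset.sum_mul]
  refine Finset.sum_le_sum fun i _ => ?_
  have hsplit := measureReal_inter_add_sdiff (μ := μ) (s := B i)
    (Finset.measurableSet_biUnion (Finset.univ.erase i) fun j _ => hA j)
  linarith [hcollision i]

end Events

section Scan

variable {n k : ℕ}

lemma exists_find?_eq_some_of_pairwise {α : Type*} {r : α → α → Prop} (hr : ∀ a, r a a)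
    {p : α → Bool} {l : List α} (hl : l.Pairwise r) {a : α} (ha : a ∈ l) (hpa : p a) :
    ∃ b ∈ l, p b ∧ r b a ∧ l.find? p = some b := by
  induction l with
  | nil => simp at ha
  | cons c l ih =>
    obtain ⟨hcl, hl⟩ := List.pairwise_cons.1 hl
    by_cases hpc : p c
    · refine ⟨c, List.mem_cons_self, hpc, ?_, List.find?_cons_of_pos hpc⟩
      rcases List.mem_cons.1 ha with rfl | ha
      exacts [hr _, hcl a ha]
    · have ha : a ∈ l := (List.mem_cons.1 ha).resolve_left (by rintro rfl; exact hpc hpa)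
      obtain ⟨b, hb, hpb, hba, hfind⟩ := ih hl ha
      exact ⟨b, List.mem_cons_of_mem _ hb, hpb, hba, by rwa [List.find?_cons_of_neg hpc]⟩

lemma mem_arrivals {v : Fin k → Fin n → ℝ≥0} {a : ℕ × ℝ≥0} :
    a ∈ arrivals v ↔ ∃ (s : Fin k) (i : Fin n), ((s : ℕ), v s i) = a := by
  simp only [arrivals, List.mem_flatMap, List.mem_finRange, true_and, List.mem_ofFn]

lemma pairwise_arrivals (v : Fin k → Fin n → ℝ≥0) :
    (arrivals v).Pairwise fun a b => a.1 ≤ b.1 := by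
  rw [arrivals, List.pairwise_flatMap]
  refine ⟨fun s _ => List.pairwise_ofFn.2 fun _ _ _ => le_rfl,
    (List.pairwise_lt_finRange k).imp fun hst a ha b hb => ?_⟩
  obtain ⟨i, rfl⟩ := List.mem_ofFn.1 ha
  obtain ⟨j, rfl⟩ := List.mem_ofFn.1 hb
  exact hst.le

lemma exists_scan_eq {P : ℕ → ℝ≥0 → Prop} {v : Fin k → Fin n → ℝ≥0} {s : Fin k} {i : Fin n}
    (h : P s (v s i)) :
    ∃ s' ≤ s, ∃ i', P s' (v s' i') ∧ scan P v = v s' i' := by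
  classical
  obtain ⟨b, hb, hPb, hbs, hfind⟩ := exists_find?_eq_some_of_pairwise
    (r := fun a b => a.1 ≤ b.1) (p := fun a => decide (P a.1 a.2)) (fun _ => le_rfl)
    (pairwise_arrivals v) (mem_arrivals.2 ⟨s, i, rfl⟩) (decide_eq_true h)
  obtain ⟨s', i', rfl⟩ := mem_arrivals.1 hb
  refine ⟨s', hbs, i', of_decide_eq_true hPb, ?_⟩
  rw [scan, hfind]
  rfl

lemma measurable_find?_elim {Ω α β : Type*} [MeasurableSpace Ω] [MeasurableSpace β] {d : β}
    {P : α → β → Prop} [∀ a x, Decidable (P a x)] (hP : ∀ a, MeasurableSet {x | P a x})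
    {l : List (α × (Ω → β))} (hl : ∀ a ∈ l, Measurable a.2) :
    Measurable fun ω =>
      ((l.map fun a => (a.1, a.2 ω)).find? fun a => decide (P a.1 a.2)).elim d Prod.snd := by
  induction l with
  | nil => exact measurable_const
  | cons a l ih =>
    have ha := hl a List.mem_cons_self
    have hunfold : ∀ ω, (((a :: l).map fun a => (a.1, a.2 ω)).find?
        fun a => decide (P a.1 a.2)).elim d Prod.snd = if P a.1 (a.2 ω) then a.2 ω else
        ((l.map fun a => (a.1, a.2 ω)).find? fun a => decide (P a.1 a.2)).elim d Prod.snd := by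
      intro ω
      by_cases h : P a.1 (a.2 ω) <;> simp [h]
    simp only [hunfold]
    exact Measurable.ite (ha (hP a.1)) ha (ih fun b hb => hl b (List.mem_cons_of_mem a hb))

lemma measurable_scan {P : ℕ → ℝ≥0 → Prop} (hP : ∀ s, MeasurableSet {x | P s x}) :
    Measurable fun v : Fin k → Fin n → ℝ≥0 => scan P v := by
  classical
  have hfind := measurable_find?_elim (d := 0) hP
    (l := (List.finRange k).flatMap fun s : Fin k =>
      List.ofFn fun i : Fin n => ((s : ℕ), fun v : Fin k → Fin n → ℝ≥0 => v s i)) (by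
      simp only [List.mem_flatMap, List.mem_finRange, true_and, List.mem_ofFn]
      rintro a ⟨s, i, rfl⟩
      exact (measurable_pi_apply i).comp (measurable_pi_apply s))
  convert hfind using 2 with v
  simp only [scan, arrivals, List.map_flatMap, List.map_ofFn, Function.comp_def]

lemma measurableSet_accepts (T : ℕ → ℝ) (m s : ℕ) : MeasurableSet {x | accepts T m s x} := by
  unfold accepts
  split_ifs
  · exact measurable_coe_nnreal_real measurableSet_Ioi
  · exact (MeasurableSet.const _).inter (measurable_coe_nnreal_real measurableSet_Ici)

lemma accepts_iff_of_lt_two {T : ℕ → ℝ} {m s : ℕ} (hs : s < 2) {x : ℝ≥0} :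
    accepts T m s x ↔ T 0 < (x : ℝ) := by
  rw [accepts, if_pos hs]

lemma accepts_iff_of_two_le {T : ℕ → ℝ} {m s : ℕ} (hs : 2 ≤ s) {x : ℝ≥0} :
    accepts T m s x ↔ s < 2 + m ∧ T (s - 3) ≤ (x : ℝ) := by
  rw [accepts, if_neg hs.not_gt]

end Scan

section Constant

lemma xi_pos : 0 < xi := by
  have : √5 < 3 := (Real.sqrt_lt' (by norm_num)).2 (by norm_num)
  rw [xi]
  linarith

lemma xi_lt_one : xi < 1 := by
  have : 1 < √5 := (Real.lt_sqrt (by norm_num)).2 (by norm_num)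
  rw [xi]
  linarith

lemma one_sub_xi_mul_two_sub_xi : (1 - xi) * (2 - xi) = 1 := by
  rw [xi]
  linear_combination (1 / 4) * Real.sq_sqrt (show (0 : ℝ) ≤ 5 by norm_num)

lemma inv_pow_two_pow_le_of_logb_logb_le {b ε : ℝ} (hb : 1 < b) (hε0 : 0 < ε) (hε1 : ε < 1)
    {N : ℕ} (hN : Real.logb 2 (Real.logb b (1 / ε)) ≤ N) : (1 / b) ^ 2 ^ N ≤ ε := by
  have hb0 : 0 < b := one_pos.trans hb
  have hlog : 0 < Real.logb b (1 / ε) := Real.logb_pos hb ((one_lt_div hε0).2 hε1)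
  rw [Real.logb_le_iff_le_rpow one_lt_two hlog, Real.rpow_natCast,
    Real.logb_le_iff_le_rpow hb (by positivity)] at hN
  rw [one_div_pow, one_div_le (by positivity) hε0]
  exact_mod_cast hN

lemma inv_one_add_xi_pow_le {ε : ℝ} (hε0 : 0 < ε) (hε1 : ε < 1) {N : ℕ} (hN : rounds ε ≤ N) :
    (1 / (1 + xi)) ^ 2 ^ N ≤ ε :=
  inv_pow_two_pow_le_of_logb_logb_le (lt_add_of_pos_right 1 xi_pos) hε0 hε1
    ((Int.le_ceil _).trans (by exact_mod_cast hN))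

end Constant

section OneRound

variable {n : ℕ} {F : Measure (Fin n → ℝ≥0)}

/-- The distributions of reward vectors whose coordinates are pairwise negatively quadrant
dependent: being large is never positively correlated for two rewards. Largeness is expressed by
arbitrary upper sets, so that both open and closed half-lines are covered. -/
def pairwiseNegativelyDependent (n : ℕ) : Set (Measure (Fin n → ℝ≥0)) :=
  {F | IsProbabilityMeasure F ∧
    ∀ i j : Fin n, i ≠ j → ∀ A B : Set ℝ≥0, IsUpperSet A → IsUpperSet B →
      F.real ({v | v i ∈ A} ∩ {v | v j ∈ B}) ≤ F.real {v | v i ∈ A} * F.real {v | v j ∈ B}}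

lemma pairwiseIndependent_subset_pairwiseNegativelyDependent :
    pairwiseIndependent n ⊆ pairwiseNegativelyDependent n := by
  refine fun F hF => ⟨hF.1, fun i j hij A B hA hB => ?_⟩
  have hindep := (hF.2 hij).measure_inter_preimage_eq_mul _ _ hA.ordConnected.measurableSet
    hB.ordConnected.measurableSet
  simp only [measureReal_def, ← ENNReal.toReal_mul]
  exact (congrArg ENNReal.toReal hindep).le

lemma le_maxReward (v : Fin n → ℝ≥0) (i : Fin n) : (v i : ℝ) ≤ maxReward v :=
  NNReal.coe_le_coe.2 (Finset.le_sup (Finset.mem_univ i))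

lemma exists_maxReward_eq [NeZero n] (v : Fin n → ℝ≥0) : ∃ i, maxReward v = v i := by
  obtain ⟨i, -, hi⟩ := Finset.exists_mem_eq_sup Finset.univ Finset.univ_nonempty v
  exact ⟨i, hi⟩

lemma measurable_maxReward : Measurable (maxReward : (Fin n → ℝ≥0) → ℝ≥0) :=
  (Continuous.finset_sup_apply fun i _ => continuous_apply i).measurable

lemma measurable_coe_maxReward : Measurable fun v : Fin n → ℝ≥0 => (maxReward v : ℝ) :=
  measurable_maxReward.coe_nnreal_real

lemma measurable_coe_apply (i : Fin n) : Measurable fun v : Fin n → ℝ≥0 => (v i : ℝ) :=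
  (measurable_pi_apply i).coe_nnreal_real

lemma real_lt_maxReward_le_sum [NeZero n] [IsFiniteMeasure F] (t : ℝ) :
    F.real {v | t < (maxReward v : ℝ)} ≤ ∑ i, F.real {v | t < (v i : ℝ)} := by
  refine (measureReal_mono fun v hv => ?_).trans (measureReal_iUnion_fintype_le _)
  obtain ⟨i, hi⟩ := exists_maxReward_eq v
  rw [Set.mem_ofPred, hi] at hv
  exact Set.mem_iUnion.2 ⟨i, hv⟩

lemma real_maxReward_lt_le (hF : F ∈ pairwiseNegativelyDependent n) {c t : ℝ} (hc : 0 ≤ c)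
    (hsum : c ≤ ∑ i, F.real {v | t ≤ (v i : ℝ)}) :
    F.real {v | (maxReward v : ℝ) < t} ≤ 1 / (1 + c) := by
  have := hF.1
  have hupper : IsUpperSet {x : ℝ≥0 | t ≤ (x : ℝ)} := fun x y hxy hx =>
    le_trans hx (NNReal.coe_le_coe.2 hxy)
  calc F.real {v | (maxReward v : ℝ) < t}
      ≤ F.real {v | ∀ i, v ∉ {v : Fin n → ℝ≥0 | t ≤ (v i : ℝ)}} :=
        measureReal_mono fun v hv i => not_le.2 ((le_maxReward v i).trans_lt hv)
    _ ≤ 1 / (1 + ∑ i, F.real {v | t ≤ (v i : ℝ)}) :=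
        measureReal_forall_notMem_le (fun i => measurable_coe_apply i measurableSet_Ici)
          fun i j hij => hF.2 i j hij _ _ hupper hupper
    _ ≤ 1 / (1 + c) := by gcongr

/-- The reward vectors of which exactly one entry exceeds `a`, and this one even exceeds `b`
(for `a ≤ b`): any algorithm that accepts exactly the rewards above `a` then earns more than
`b`. -/
def uniqueExceed (n : ℕ) (a b : ℝ) : Set (Fin n → ℝ≥0) :=
  {v | ∃ i, b < (v i : ℝ) ∧ ∀ j, j ≠ i → (v j : ℝ) ≤ a}

lemma measurableSet_uniqueExceed (a b : ℝ) : MeasurableSet (uniqueExceed n a b) := by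
  have hunion : uniqueExceed n a b = ⋃ i, {v : Fin n → ℝ≥0 | b < (v i : ℝ)} ∩
      ⋂ j, ⋂ (_ : j ≠ i), {v : Fin n → ℝ≥0 | (v j : ℝ) ≤ a} := by
    ext v
    simp [uniqueExceed]
  rw [hunion]
  exact MeasurableSet.iUnion fun i => (measurable_coe_apply i measurableSet_Ioi).inter
    (MeasurableSet.iInter fun j => MeasurableSet.iInter fun _ =>
      measurable_coe_apply j measurableSet_Iic)

lemma sum_mul_le_real_uniqueExceed (hF : F ∈ pairwiseNegativelyDependent n) {a b : ℝ}
    (hab : a ≤ b) :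
    (∑ i, F.real {v | b < (v i : ℝ)}) * (1 - ∑ i, F.real {v | a < (v i : ℝ)})
      ≤ F.real (uniqueExceed n a b) := by
  have := hF.1
  have hupper : ∀ t : ℝ, IsUpperSet {x : ℝ≥0 | t < (x : ℝ)} := fun t x y hxy hx =>
    lt_of_lt_of_le hx (NNReal.coe_le_coe.2 hxy)
  have h := sum_mul_le_measureReal_exists_forall_ne (μ := F)
    (A := fun i => {v | a < (v i : ℝ)}) (B := fun i => {v | b < (v i : ℝ)})
    (fun i => measurable_coe_apply i measurableSet_Ioi)
    (fun i => measurable_coe_apply i measurableSet_Ioi) (fun i v hv => lt_of_le_of_lt hab hv)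
    fun i j hij => hF.2 i j hij _ _ (hupper b) (hupper a)
  simpa only [uniqueExceed, Set.mem_ofPred, not_lt] using h

end OneRound

section Thresholds

variable {n : ℕ} {F : Measure (Fin n → ℝ≥0)}

lemma exists_isMaxQuantile [IsProbabilityMeasure F] {q : ℝ} (hq0 : 0 ≤ q) (hq1 : q < 1) :
    ∃ T, IsMaxQuantile F q T := by
  have hlow : ∑ _i : Unit, F.real {v | (maxReward v : ℝ) < 0} ≤ q := by
    simpa [(NNReal.coe_nonneg _).not_gt] using hq0
  simpa [IsMaxQuantile] using exists_sum_quantile (ι := Unit) (μ := F)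
    (fun _ => measurable_coe_maxReward) hlow (by simpa using hq1)

lemma exists_sum_real_lt_le_xi [NeZero n] [IsProbabilityMeasure F] :
    ∃ T : ℝ, ∑ i, F.real {v | T < (v i : ℝ)} ≤ xi ∧ xi ≤ ∑ i, F.real {v | T ≤ (v i : ℝ)} := by
  have hn : (1 : ℝ) ≤ n := by exact_mod_cast NeZero.one_le
  have hlow : ∑ i, F.real {v | (v i : ℝ) < 0} ≤ n - xi := by
    simpa [(NNReal.coe_nonneg _).not_gt] using xi_lt_one.le.trans hn
  obtain ⟨T, hlt, hle⟩ := exists_sum_quantile measurable_coe_apply hlow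
    (by simpa using xi_pos)
  refine ⟨T, ?_, ?_⟩
  · simp only [measureReal_setOf_lt_eq_one_sub (measurable_coe_apply _), Finset.sum_sub_distrib,
      Finset.sum_const, Finset.card_univ, Fintype.card_fin, nsmul_eq_mul, mul_one]
    linarith
  · simp only [measureReal_setOf_le_eq_one_sub (measurable_coe_apply _), Finset.sum_sub_distrib,
      Finset.sum_const, Finset.card_univ, Fintype.card_fin, nsmul_eq_mul, mul_one]
    linarith

lemma exists_areThresholds [NeZero n] (hF : F ∈ pairwiseNegativelyDependent n) :
    ∃ T : ℕ → ℝ, AreThresholds F T := by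
  have := hF.1
  obtain ⟨T₀, hlt, hle⟩ := exists_sum_real_lt_le_xi (F := F)
  set p := F.real {v | (maxReward v : ℝ) < T₀}
  have hp0 : 0 ≤ p := measureReal_nonneg
  have hp1 : p < 1 := (real_maxReward_lt_le hF xi_pos.le hle).trans_lt <| by
    rw [div_lt_one (by linarith [xi_pos])]
    exact lt_add_of_pos_right 1 xi_pos
  choose t ht using fun j : ℕ =>
    exists_isMaxQuantile (F := F) (pow_nonneg hp0 (2 ^ j)) (pow_lt_one₀ hp0 hp1 (by positivity))
  refine ⟨fun j => if j = 0 then T₀ else t j, ⟨by simpa using hlt, by simpa using hle⟩,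
    fun j hj => ?_⟩
  simpa [Nat.one_le_iff_ne_zero.1 hj] using ht j

namespace AreThresholds

variable {T : ℕ → ℝ}

lemma real_maxReward_lt_le_pow (hT : AreThresholds F T) (j : ℕ) :
    F.real {v | (maxReward v : ℝ) < T j} ≤ F.real {v | (maxReward v : ℝ) < T 0} ^ 2 ^ j := by
  rcases Nat.eq_zero_or_pos j with rfl | hj
  · simp
  · exact (hT.2 j hj).1

lemma real_lt_maxReward_le_one_sub_pow [IsProbabilityMeasure F] (hT : AreThresholds F T) {j : ℕ}
    (hj : 1 ≤ j) {t : ℝ} (ht : T j ≤ t) :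
    F.real {v | t < (maxReward v : ℝ)} ≤ 1 - F.real {v | (maxReward v : ℝ) < T 0} ^ 2 ^ j := by
  rw [measureReal_setOf_lt_eq_one_sub measurable_coe_maxReward]
  exact sub_le_sub_left ((hT.2 j hj).2.trans (measureReal_mono fun v hv => le_trans hv ht)) 1

lemma one_sub_xi_le_real_maxReward_le [NeZero n] [IsProbabilityMeasure F]
    (hT : AreThresholds F T) : 1 - xi ≤ F.real {v | (maxReward v : ℝ) ≤ T 0} := by
  have h := (real_lt_maxReward_le_sum (F := F) (T 0)).trans hT.1.1
  rw [measureReal_setOf_lt_eq_one_sub measurable_coe_maxReward] at h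
  linarith

end AreThresholds

end Thresholds

section Rounds

variable {n k : ℕ} {F : Measure (Fin n → ℝ≥0)} {T : ℕ → ℝ}

lemma measurableSet_lt_scan_accepts (T : ℕ → ℝ) (m : ℕ) (t : ℝ) :
    MeasurableSet {v : Fin k → Fin n → ℝ≥0 | t < (scan (accepts T m) v : ℝ)} :=
  (measurable_scan (measurableSet_accepts T m)).coe_nnreal_real measurableSet_Ioi

lemma lt_scan_of_mem_uniqueExceed {m : ℕ} {t : ℝ} (ht : T 0 ≤ t) {v : Fin k → Fin n → ℝ≥0}
    {s : Fin k} (hs : (s : ℕ) < 2) (hv : v s ∈ uniqueExceed n (T 0) t)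
    (hlow : ∀ s' < s, (maxReward (v s') : ℝ) ≤ T 0) : t < (scan (accepts T m) v : ℝ) := by
  obtain ⟨i, hi, hunique⟩ := hv
  obtain ⟨s', hs', i', hacc, hscan⟩ :=
    exists_scan_eq (P := accepts T m) ((accepts_iff_of_lt_two hs).2 (ht.trans_lt hi))
  rw [accepts_iff_of_lt_two (lt_of_le_of_lt (Fin.le_def.1 hs') hs)] at hacc
  obtain rfl : s' = s :=
    hs'.eq_of_not_lt fun hlt => ((le_maxReward _ i').trans (hlow s' hlt)).not_gt hacc
  obtain rfl : i' = i := by_contra fun hne => (hunique i' hne).not_gt hacc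
  rwa [hscan]

lemma lt_scan_of_le_maxReward [NeZero n] {m : ℕ} {t : ℝ} {v : Fin k → Fin n → ℝ≥0} {s : Fin k}
    (hs : 2 ≤ (s : ℕ)) (hsm : (s : ℕ) < 2 + m) (hv : T (s - 3) ≤ (maxReward (v s) : ℝ))
    (ht : ∀ i ≤ (s : ℕ) - 3, t < T i) : t < (scan (accepts T m) v : ℝ) := by
  obtain ⟨i, hi⟩ := exists_maxReward_eq (v s)
  rw [hi] at hv
  obtain ⟨s', hs', i', hacc, hscan⟩ :=
    exists_scan_eq (P := accepts T m) ((accepts_iff_of_two_le hs).2 ⟨hsm, hv⟩)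
  rw [hscan]
  rcases lt_or_ge (s' : ℕ) 2 with hfirst | hsecond
  · exact (ht 0 (Nat.zero_le _)).trans ((accepts_iff_of_lt_two hfirst).1 hacc)
  · exact (ht _ (Nat.sub_le_sub_right hs' 3)).trans_le ((accepts_iff_of_two_le hsecond).1 hacc).2

lemma real_lt_maxReward_le_real_lt_scan [NeZero n] (hF : F ∈ pairwiseNegativelyDependent n)
    (hT : AreThresholds F T) (m : ℕ) (hk : 2 ≤ k) {t : ℝ} (ht : T 0 ≤ t) :
    F.real {v | t < (maxReward v : ℝ)} ≤
      (Measure.pi fun _ : Fin k => F).real {v | t < (scan (accepts T m) v : ℝ)} := by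
  have := hF.1
  set S := ∑ i, F.real {v | t < (v i : ℝ)}
  set D := uniqueExceed n (T 0) t
  set L : Set (Fin n → ℝ≥0) := {v | (maxReward v : ℝ) ≤ T 0}
  set s₀ : Fin k := ⟨0, by omega⟩
  set s₁ : Fin k := ⟨1, by omega⟩
  have hxi : 0 ≤ 1 - xi := sub_nonneg.2 xi_lt_one.le
  have hS : 0 ≤ S := Finset.sum_nonneg fun i _ => measureReal_nonneg
  have hL : 1 - xi ≤ F.real L := hT.one_sub_xi_le_real_maxReward_le
  have hD : S * (1 - xi) ≤ F.real D :=
    (mul_le_mul_of_nonneg_left (sub_le_sub_left hT.1.1 1) hS).trans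
      (sum_mul_le_real_uniqueExceed hF ht)
  have hDL : Disjoint D L := Set.disjoint_left.2 fun v ⟨i, hi, _⟩ hv =>
    ((le_maxReward v i).trans hv).not_gt (ht.trans_lt hi)
  calc F.real {v | t < (maxReward v : ℝ)}
      ≤ S := real_lt_maxReward_le_sum t
    _ = S * (1 - xi) + (1 - xi) * (S * (1 - xi)) := by
        linear_combination -S * one_sub_xi_mul_two_sub_xi
    _ ≤ F.real D + F.real L * F.real D := by gcongr
    _ = (Measure.pi fun _ : Fin k => F).real {v | v s₀ ∈ D ∨ v s₀ ∈ L ∧ v s₁ ∈ D} :=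
        (measureReal_pi_mem_or_mem_and_mem (by simp [s₀, s₁]) (measurableSet_uniqueExceed _ _)
          (measurable_coe_maxReward measurableSet_Iic) hDL).symm
    _ ≤ (Measure.pi fun _ : Fin k => F).real {v | t < (scan (accepts T m) v : ℝ)} := by
        refine measureReal_mono fun v hv => ?_
        rcases hv with hfirst | ⟨hlow, hsecond⟩
        · exact lt_scan_of_mem_uniqueExceed ht two_pos hfirst fun s hs =>
            absurd (Fin.lt_def.1 hs) (Nat.not_lt_zero _)
        · refine lt_scan_of_mem_uniqueExceed ht one_lt_two hsecond fun s hs => ?_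
          rwa [show s = s₀ from Fin.ext (Nat.lt_one_iff.1 hs)]

lemma mul_prod_pow_two_pow {M : Type*} [CommMonoid M] (p : M) (l : ℕ) :
    p * ∏ i ∈ Finset.range l, p ^ 2 ^ i = p ^ 2 ^ l := by
  induction l with
  | zero => simp
  | succ l ih => rw [Finset.prod_range_succ, ← mul_assoc, ih, ← pow_add, pow_succ 2 l, mul_two]

lemma one_sub_pow_le_real_lt_scan [NeZero n] [IsProbabilityMeasure F] (hT : AreThresholds F T)
    {m l : ℕ} (hl : l < m) (hk : l + 3 ≤ k) {t : ℝ} (ht : ∀ i ≤ l - 1, t < T i) :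
    1 - F.real {v | (maxReward v : ℝ) < T 0} ^ 2 ^ l ≤
      (Measure.pi fun _ : Fin k => F).real {v | t < (scan (accepts T m) v : ℝ)} := by
  set p := F.real {v | (maxReward v : ℝ) < T 0}
  let round : Fin (l + 1) → Fin k := fun j => ⟨j + 2, by omega⟩
  have hround : round.Injective := fun i j h => Fin.ext (by simpa [round] using h)
  let fail : Fin (l + 1) → Set (Fin n → ℝ≥0) := fun j => {v | (maxReward v : ℝ) < T (j - 1)}
  have hfail : ∀ v ∈ {v : Fin k → Fin n → ℝ≥0 | t < (scan (accepts T m) v : ℝ)}ᶜ,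
      ∀ j, v (round j) ∈ fail j := by
    intro v hv j
    by_contra hj
    exact hv <| lt_scan_of_le_maxReward (s := round j) (Nat.le_add_left 2 j)
      (by simp only [round]; omega) (not_lt.1 hj) fun i hi =>
        ht i (hi.trans (by simp only [round]; omega))
  have hprob : (Measure.pi fun _ : Fin k => F).real
      {v | t < (scan (accepts T m) v : ℝ)}ᶜ ≤ p ^ 2 ^ l :=
    calc (Measure.pi fun _ : Fin k => F).real {v | t < (scan (accepts T m) v : ℝ)}ᶜ
        ≤ (Measure.pi fun _ : Fin k => F).real {v | ∀ j, v (round j) ∈ fail j} :=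
          measureReal_mono hfail
      _ = ∏ j, F.real (fail j) :=
          measureReal_pi_forall_mem (fun _ => F) hround fun j =>
            measurable_coe_maxReward measurableSet_Iio
      _ = p * ∏ i : Fin l, F.real {v | (maxReward v : ℝ) < T i} := Fin.prod_univ_succ _
      _ ≤ p * ∏ i : Fin l, p ^ 2 ^ (i : ℕ) := by
          gcongr with i
          exact hT.real_maxReward_lt_le_pow i
      _ = p ^ 2 ^ l := by
          rw [Fin.prod_univ_eq_prod_range fun i => p ^ 2 ^ i, mul_prod_pow_two_pow]
  rw [probReal_compl_eq_one_sub (measurableSet_lt_scan_accepts T m t)] at hprob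
  exact sub_le_comm.1 hprob

lemma mul_real_lt_maxReward_le [NeZero n] (hF : F ∈ pairwiseNegativelyDependent n)
    (hT : AreThresholds F T) {ε : ℝ} (hε0 : 0 ≤ ε) (hε1 : ε ≤ 1) {N : ℕ} (hk : N + 3 ≤ k)
    (hN : (1 / (1 + xi)) ^ 2 ^ N ≤ ε) (t : ℝ) :
    (1 - ε) * F.real {v | t < (maxReward v : ℝ)} ≤
      (Measure.pi fun _ : Fin k => F).real {v | t < (scan (accepts T (N + 1)) v : ℝ)} := by
  have := hF.1
  have hle : (1 - ε) * F.real {v | t < (maxReward v : ℝ)} ≤ F.real {v | t < (maxReward v : ℝ)} :=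
    mul_le_of_le_one_left measureReal_nonneg (sub_le_self 1 hε0)
  rcases le_or_gt (T 0) t with ht | ht
  · exact hle.trans (real_lt_maxReward_le_real_lt_scan hF hT _ (by omega) ht)
  by_cases hex : ∃ l < N, T l ≤ t
  · classical
    obtain ⟨l, ⟨hlN, hl⟩, hmin⟩ := Nat.findX hex
    have hl0 : l ≠ 0 := by
      rintro rfl
      exact ht.not_ge hl
    calc (1 - ε) * F.real {v | t < (maxReward v : ℝ)}
        ≤ F.real {v | t < (maxReward v : ℝ)} := hle
      _ ≤ 1 - F.real {v | (maxReward v : ℝ) < T 0} ^ 2 ^ l :=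
          hT.real_lt_maxReward_le_one_sub_pow (Nat.one_le_iff_ne_zero.2 hl0) hl
      _ ≤ (Measure.pi fun _ : Fin k => F).real {v | t < (scan (accepts T (N + 1)) v : ℝ)} :=
          one_sub_pow_le_real_lt_scan hT (by omega) (by omega) fun i hi =>
            not_le.1 fun hi' => hmin i (by omega) ⟨by omega, hi'⟩
  · push Not at hex
    have hfail : F.real {v | (maxReward v : ℝ) < T 0} ^ 2 ^ N ≤ ε :=
      (pow_le_pow_left₀ measureReal_nonneg (real_maxReward_lt_le hF xi_pos.le hT.1.2) _).trans hN
    calc (1 - ε) * F.real {v | t < (maxReward v : ℝ)}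
        ≤ 1 - ε := mul_le_of_le_one_right (sub_nonneg.2 hε1) measureReal_le_one
      _ ≤ 1 - F.real {v | (maxReward v : ℝ) < T 0} ^ 2 ^ N := sub_le_sub_left hfail 1
      _ ≤ (Measure.pi fun _ : Fin k => F).real {v | t < (scan (accepts T (N + 1)) v : ℝ)} :=
          one_sub_pow_le_real_lt_scan hT N.lt_succ_self hk fun i hi => by
            rcases Nat.eq_zero_or_pos i with rfl | hi0
            exacts [ht, hex i (by omega)]

lemma suffices_twoPhase [NeZero n] {C : Set (Measure (Fin n → ℝ≥0))}
    (hC : C ⊆ pairwiseNegativelyDependent n) {T : Measure (Fin n → ℝ≥0) → ℕ → ℝ}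
    (hT : ∀ F ∈ C, AreThresholds F (T F)) {ε : ℝ} (hε0 : 0 < ε) (hε1 : ε < 1)
    (hr : -1 ≤ rounds ε) : Suffices C (twoPhase n T ε) ε (rounds ε + 4).toNat := by
  intro F hF k hk
  have := (hC hF).1
  obtain ⟨N, hN⟩ := Int.eq_ofNat_of_zero_le (show 0 ≤ rounds ε + 1 by omega)
  have hm : (rounds ε + 2).toNat = N + 1 := by omega
  simp only [twoPhase, hm]
  refine mul_lintegral_le_of_forall_mul_meas_lt_le measurable_maxReward
    (measurable_scan (measurableSet_accepts (T F) _)) ENNReal.ofReal_ne_top fun t => ?_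
  have htail := mul_real_lt_maxReward_le (hC hF) (hT F hF) hε0.le hε1.le (by omega : N + 3 ≤ k)
    (inv_one_add_xi_pow_le hε0 hε1 (by omega)) t
  have htail' := ENNReal.ofReal_le_ofReal htail
  rwa [ENNReal.ofReal_mul (sub_nonneg.2 hε1.le), ofReal_measureReal, ofReal_measureReal] at htail'

end Rounds

end Prophet

theorem theorem3_general (n : ℕ) (hn : 0 < n) (ε : ℝ) (hε0 : 0 < ε) (hε1 : ε < 1)
    (hr : -1 ≤ Prophet.rounds ε) {C : Set (Measure (Fin n → ℝ≥0))}
    (hC : C ⊆ Prophet.pairwiseNegativelyDependent n) :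
    (∀ F ∈ C, ∃ T : ℕ → ℝ, Prophet.AreThresholds F T) ∧
    ∀ T : Measure (Fin n → ℝ≥0) → ℕ → ℝ, (∀ F ∈ C, Prophet.AreThresholds F (T F)) →
      Prophet.competitionComplexity C (Prophet.twoPhase n T ε) ε
        ≤ ((Prophet.rounds ε + 4).toNat : ℕ∞) := by
  have : NeZero n := ⟨hn.ne'⟩
  refine ⟨fun F hF => Prophet.exists_areThresholds (hC hF), fun T hT => ?_⟩
  exact iInf₂_le _ ⟨by omega, Prophet.suffices_twoPhase hC hT hε0 hε1 hr⟩

theorem theorem3 (n : ℕ) (hn : 0 < n) (ε : ℝ) (hε0 : 0 < ε) (hε1 : ε < 1)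
    (hr : -1 ≤ Prophet.rounds ε) :
    (∀ F ∈ Prophet.pairwiseIndependent n, ∃ T : ℕ → ℝ, Prophet.AreThresholds F T) ∧
    ∀ T : Measure (Fin n → ℝ≥0) → ℕ → ℝ,
      (∀ F ∈ Prophet.pairwiseIndependent n, Prophet.AreThresholds F (T F)) →
      Prophet.competitionComplexity (Prophet.pairwiseIndependent n) (Prophet.twoPhase n T ε) ε
        ≤ ((Prophet.rounds ε + 4).toNat : ℕ∞) :=
  theorem3_general n hn ε hε0 hε1 hr
    Prophet.pairwiseIndependent_subset_pairwiseNegativelyDependent
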